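/- Let $n \ge 1$ and $[n]=\{1,\dots,n\}$. Vectors $\pi\in\mathbb{R}^{2^n-1}$ are indexed by the nonempty subsets $S\subseteq[n]$. An object is a compact subset $T$ of the nonnegative orthant $\mathbb{R}^n_+=[0,\infty)^n$. For nonempty $S\subseteq[n]$, $|T_S|$ denotes the $|S|$-dimensional volume of the orthogonal projection of $T$ onto the coordinate subspace $\operatorname{span}\{v_i : i\in S\}$, where $v_1,\dots,v_n$ is the standard basis; the log-projection vector of $T$ is $(\log|T_S|)_{S}$, with $\log 0=-\infty$. Let $\Psi_n\subseteq\mathbb{R}^{2^n-1}$ be the set of all real vectors that are log-projection vectors of objects. A rectangular flower is an object $F\subseteq\mathbb{R}^n_+$ such that (1) $F$ is cornered, i.e. $x\in F$, $y\in\mathbb{R}^n_+$ and $y_i\le x_i$ for all $i$ imply $y\in F$; and (2) for every $S\subseteq[n]$ there are real numbers $a_i$ ($i \in S$) such that $$\{x\in F : x_i>0 \text{ for } i\in S,\ x_i=0\text{ for } i\notin S\}=\{x\in\mathbb{R}^n : 0<x_i\le a_i\text{ for }i\in S,\ x_i=0\text{ for }i\notin S\}.$$ Let $\mathcal{RF}_n\subseteq\mathbb{R}^{2^n-1}$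 be the set of all real vectors that are log-projection vectors of rectangular flowers. Let $\mathcal{A}=(A_i)_{i=1}^k$ and $\mathcal{B}=(B_j)_{j=1}^m$ be finite families of nonempty subsets of $[n]$, repetitions allowed. We say that $\mathcal{A}$ covers $\mathcal{B}$ if $|\{i : e\in A_i\}|=|\{j: e\in B_j\}|$ for every $e\in[n]$, and there is a bijection from $\{(i,t): t\in A_i\}$ to $\{(j,s): s\in B_j\}$ such that whenever $(i,t)$ is sent to $(j,s)$, one has $s=t$ and $A_i\subseteq B_j$. Let $\mathcal{NC}_n$ be the set of all $\pi\in\mathbb{R}^{2^n-1}$ such that $\sum_{j}\pi_{B_j}\le\sum_i\pi_{A_i}$ for all $\mathcal{A},\mathcal{B}$ such that $\mathcal{A}$ covers $\mathcal{B}$. Then, for all $n\ge 1$, $$\mathcal{NC}_n=\mathcal{RF}_n\subseteq\Psi_n.$$ -/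

import Mathlib

/-- The index set of a `(2^n - 1)`-dimensional vector: the nonempty subsets of `[n]`. -/
abbrev NonemptySubset (n : ℕ) : Type := {S : Finset (Fin n) // S.Nonempty}

/-- An object: a (bounded) compact subset of the nonnegative orthant `ℝ₊ⁿ`. -/
def IsObject {n : ℕ} (T : Set (Fin n → ℝ)) : Prop :=
  IsCompact T ∧ ∀ x ∈ T, ∀ i, 0 ≤ x i

/-- `|T_S|`: the `|S|`-dimensional Lebesgue measure of the orthogonal projection of `T` onto
the coordinate subspace spanned by `{v_i | i ∈ S}`, identified with `ℝ^S` through its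
standard orthonormal basis, so that the projection is the restriction of coordinates to `S`. -/
noncomputable def projVolume {n : ℕ} (T : Set (Fin n → ℝ)) (S : Finset (Fin n)) : ENNReal :=
  MeasureTheory.volume ((fun (x : Fin n → ℝ) (i : S) => x i) '' T)

/-- The log-projection vector of `T`, with values in `[-∞, ∞]` since `log 0 = -∞`. -/
noncomputable def logProjection {n : ℕ} (T : Set (Fin n → ℝ)) (S : NonemptySubset n) : EReal :=
  ENNReal.log (projVolume T S.1)

/-- The constructible region `Ψ_n`: the real vectors that are log-projection vectors of
objects. -/
def constructibleRegion (n : ℕ) : Set (NonemptySubset n → ℝ) :=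
  {p | ∃ T : Set (Fin n → ℝ), IsObject T ∧ ∀ S, (p S : EReal) = logProjection T S}

/-- A set in the nonnegative orthant is cornered if it contains, with a point `x`, every
point `y` of the orthant with `y ≤ x`. -/
def IsCornered {n : ℕ} (F : Set (Fin n → ℝ)) : Prop :=
  ∀ x ∈ F, ∀ y : Fin n → ℝ, (∀ i, 0 ≤ y i) → (∀ i, y i ≤ x i) → y ∈ F

/-- The open coordinate face `(0,∞)^S`, as a subset of `ℝⁿ`. -/
def openFace {n : ℕ} (S : Finset (Fin n)) : Set (Fin n → ℝ) :=
  {x | (∀ i ∈ S, 0 < x i) ∧ ∀ i ∉ S, x i = 0}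

/-- The rectangle `∏_{i ∈ S} (0, a i]` in the open coordinate face `(0,∞)^S`. -/
def openRectangle {n : ℕ} (S : Finset (Fin n)) (a : Fin n → ℝ) : Set (Fin n → ℝ) :=
  {x | (∀ i ∈ S, 0 < x i ∧ x i ≤ a i) ∧ ∀ i ∉ S, x i = 0}

/-- A rectangular flower: a cornered object whose trace on each open coordinate face is an
open rectangle of this face. -/
def IsRectangularFlower {n : ℕ} (F : Set (Fin n → ℝ)) : Prop :=
  IsObject F ∧ IsCornered F ∧
    ∀ S : Finset (Fin n), ∃ a : Fin n → ℝ, F ∩ openFace S = openRectangle S a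

/-- `RF_n`: the real vectors that are log-projection vectors of rectangular flowers. -/
def rectangularFlowerRegion (n : ℕ) : Set (NonemptySubset n → ℝ) :=
  {p | ∃ F : Set (Fin n → ℝ),
    IsRectangularFlower F ∧ ∀ S, (p S : EReal) = logProjection F S}

/-- `A` covers `B`, for two finite families (repetitions allowed) of nonempty subsets of `[n]`:
every element lies in as many members of `A` as of `B`, and there is a bijection from the pairs
`(A_i, t)`, `t ∈ A_i`, to the pairs `(B_j, s)`, `s ∈ B_j`, which sends `(A_i, t)` to some
`(B_j, t)` with `A_i ⊆ B_j`. -/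
def Covers {n k m : ℕ} (A : Fin k → NonemptySubset n) (B : Fin m → NonemptySubset n) : Prop :=
  (∀ e : Fin n,
    (Finset.univ.filter fun i => e ∈ (A i).1).card =
      (Finset.univ.filter fun j => e ∈ (B j).1).card) ∧
  ∃ f : (Σ i : Fin k, {t : Fin n // t ∈ (A i).1}) ≃ (Σ j : Fin m, {s : Fin n // s ∈ (B j).1}),
    ∀ q, ((f q).2 : Fin n) = (q.2 : Fin n) ∧ (A q.1).1 ⊆ (B (f q).1).1

/-- `NC_n`: the vectors that satisfy all nonuniform-cover inequalities. -/
def nonuniformCoverCone (n : ℕ) : Set (NonemptySubset n → ℝ) :=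
  {p | ∀ (k m : ℕ) (A : Fin k → NonemptySubset n) (B : Fin m → NonemptySubset n),
    Covers A B → ∑ j, p (B j) ≤ ∑ i, p (A i)}

/-! Both sets consist of the vectors `p S = ∑ i ∈ S, x S i` with `x T i ≤ x S i` for `i ∈ S ⊆ T`.
For flowers, `x S i` is the logarithm of the `i`-th side of the box on the face `S`, and
corneredness is the monotonicity.

For `NC_n`, a cover bounds the `x`-sum of `B` by that of `A` term by term. Conversely, if no such
`x` exists, Farkas' lemma gives a certificate. Its coefficients can be natural numbers because the
system is integral, so those on the equations for `p` are multiplicities of two families `A` and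
`B`. Hall's theorem shows that `A` covers `B`, and the resulting inequality contradicts the
certificate. -/

/-! ### Farkas' lemma with natural certificates -/

/-- The half-lines `{t | a k * t ≤ c k}` have a common point as soon as any two of them that
bound `t` from opposite sides are compatible. -/
theorem exists_forall_mul_le {ι : Type*} [Fintype ι] (a : ι → ℤ) (c : ι → ℝ)
    (h0 : ∀ k, a k = 0 → 0 ≤ c k)
    (h : ∀ k l, 0 < a k → a l < 0 → 0 ≤ ((-a l : ℤ) : ℝ) * c k + (a k : ℝ) * c l) :
    ∃ t : ℝ, ∀ k, (a k : ℝ) * t ≤ c k := by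
  classical
  have key : ∀ k l, 0 < a k → a l < 0 → c l / a l ≤ c k / a k := by
    intro k l hk hl
    have h1 := h k l hk hl
    have hk' : (0 : ℝ) < a k := by exact_mod_cast hk
    have hl' : (a l : ℝ) < 0 := by exact_mod_cast hl
    push_cast at h1
    rw [div_le_iff_of_neg hl', div_mul_eq_mul_div, div_le_iff₀ hk']
    linarith
  have lower : ∀ t k, a k < 0 → c k / a k ≤ t → (a k : ℝ) * t ≤ c k := by
    intro t k hk ht
    have hk' : (a k : ℝ) < 0 := by exact_mod_cast hk
    rw [div_le_iff_of_neg hk'] at ht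
    linarith
  have upper : ∀ t k, 0 < a k → t ≤ c k / a k → (a k : ℝ) * t ≤ c k := by
    intro t k hk ht
    have hk' : (0 : ℝ) < a k := by exact_mod_cast hk
    rw [le_div_iff₀ hk'] at ht
    linarith
  have zero : ∀ t k, a k = 0 → (a k : ℝ) * t ≤ c k := by
    intro t k hk
    simpa [hk] using h0 k hk
  set N := Finset.univ.filter fun k => a k < 0 with hN
  set P := Finset.univ.filter fun k => 0 < a k with hP
  rcases N.eq_empty_or_nonempty with hne | hne
  · rcases P.eq_empty_or_nonempty with hpe | hpe
    · refine ⟨0, fun k => ?_⟩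
      rcases lt_trichotomy (a k) 0 with hk | hk | hk
      · exact absurd (show k ∈ N by simp [hN, hk]) (by simp [hne])
      · exact zero _ k hk
      · exact absurd (show k ∈ P by simp [hP, hk]) (by simp [hpe])
    · obtain ⟨m, -, hmin⟩ := P.exists_min_image (fun k => c k / a k) hpe
      refine ⟨c m / a m, fun k => ?_⟩
      rcases lt_trichotomy (a k) 0 with hk | hk | hk
      · exact absurd (show k ∈ N by simp [hN, hk]) (by simp [hne])
      · exact zero _ k hk
      · exact upper _ k hk (hmin k (by simp [hP, hk]))
  · obtain ⟨m, hm, hmax⟩ := N.exists_max_image (fun k => c k / a k) hne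
    refine ⟨c m / a m, fun k => ?_⟩
    rcases lt_trichotomy (a k) 0 with hk | hk | hk
    · exact lower _ k hk (hmax k (by simp [hN, hk]))
    · exact zero _ k hk
    · exact upper _ k hk (key k m hk (by simpa [hN] using hm))

/-- Farkas' lemma for a system of inequalities with integer coefficients and real right-hand
sides: certificates of infeasibility can be taken with natural coefficients. -/
theorem exists_solution_of_nat_certificates_fin (n : ℕ) :
    ∀ {ι : Type} [Fintype ι] (a : ι → Fin n → ℤ) (b : ι → ℝ),
      (∀ u : ι → ℕ, (∀ j, ∑ k, (u k : ℤ) * a k j = 0) → 0 ≤ ∑ k, (u k : ℝ) * b k) →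
      ∃ x : Fin n → ℝ, ∀ k, ∑ j, (a k j : ℝ) * x j ≤ b k := by
  induction n with
  | zero =>
    intro ι _ a b h
    classical
    refine ⟨0, fun k => ?_⟩
    have := h (Pi.single k 1) (fun j => j.elim0)
    simpa [Pi.single_apply] using this
  | succ n ih =>
    intro ι _ a b h
    classical
    -- Fourier–Motzkin elimination of variable `0`: keep the rows free of it and combine each pair
    -- of rows of opposite signs so that it cancels. Unused indices give the trivial row `0 ≤ 0`.
    let c : ι ⊕ ι × ι → ι → ℕ := Sum.elim
      (fun k => if a k 0 = 0 then Pi.single k 1 else 0)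
      (fun q => if 0 < a q.1 0 ∧ a q.2 0 < 0 then
        Pi.single q.1 (-a q.2 0).toNat + Pi.single q.2 (a q.1 0).toNat else 0)
    have hc : ∀ q, ∑ k, (c q k : ℤ) * a k 0 = 0 := by
      rintro (k | ⟨k, l⟩)
      · by_cases hk : a k 0 = 0 <;> simp [c, hk, Pi.single_apply]
      · by_cases hkl : 0 < a k 0 ∧ a l 0 < 0
        · have e1 : max (-a l 0) 0 = -a l 0 := max_eq_left (by omega)
          have e2 : max (a k 0) 0 = a k 0 := max_eq_left (by omega)
          simp [c, hkl, Pi.single_apply, add_mul, Finset.sum_add_distrib, e1, e2]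
          ring
        · simp [c, hkl]
    obtain ⟨x, hx⟩ := ih (fun q j => ∑ k, (c q k : ℤ) * a k j.succ)
      (fun q => ∑ k, (c q k : ℝ) * b k) (by
        intro u hu
        -- A certificate for the reduced system, composed with the multipliers `c`, is one for the
        -- original system.
        have := h (fun k => ∑ q, u q * c q k) (by
          intro j
          have e : ∑ k, ((∑ q, u q * c q k : ℕ) : ℤ) * a k j =
              ∑ q, (u q : ℤ) * ∑ k, (c q k : ℤ) * a k j := by
            push_cast
            simp_rw [Finset.sum_mul, Finset.mul_sum, mul_assoc]
            exact Finset.sum_comm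
          rw [e]
          refine Fin.cases ?_ (fun j => ?_) j
          · simp [hc]
          · exact hu j)
        convert this using 1
        push_cast
        simp_rw [Finset.sum_mul, Finset.mul_sum, mul_assoc]
        exact Finset.sum_comm)
    have hx' : ∀ q, 0 ≤ ∑ k, (c q k : ℝ) * (b k - ∑ j : Fin n, (a k j.succ : ℝ) * x j) := by
      intro q
      have h1 := hx q
      have e : ∑ j : Fin n, ((∑ k, (c q k : ℤ) * a k j.succ : ℤ) : ℝ) * x j =
          ∑ k, (c q k : ℝ) * ∑ j : Fin n, (a k j.succ : ℝ) * x j := by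
        push_cast
        simp_rw [Finset.sum_mul, Finset.mul_sum, mul_assoc]
        exact Finset.sum_comm
      rw [e] at h1
      simp_rw [mul_sub, Finset.sum_sub_distrib]
      linarith
    obtain ⟨t, ht⟩ := exists_forall_mul_le (fun k => a k 0)
      (fun k => b k - ∑ j : Fin n, (a k j.succ : ℝ) * x j)
      (by
        intro k hk
        have := hx' (Sum.inl k)
        simpa [c, hk, Pi.single_apply] using this)
      (by
        intro k l hk hl
        have h1 := hx' (Sum.inr (k, l))
        have e1 : (((-a l 0).toNat : ℕ) : ℝ) = ((-a l 0 : ℤ) : ℝ) := by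
          exact_mod_cast Int.toNat_of_nonneg (by omega : 0 ≤ -a l 0)
        have e2 : (((a k 0).toNat : ℕ) : ℝ) = (a k 0 : ℝ) := by
          exact_mod_cast Int.toNat_of_nonneg hk.le
        simp only [c, Sum.elim_inr, hk, hl, and_self, if_true, Pi.add_apply, Pi.single_apply,
          Nat.cast_add, Nat.cast_ite, Nat.cast_zero, add_mul, ite_mul, zero_mul,
          Finset.sum_add_distrib, Finset.sum_ite_eq', Finset.mem_univ, e1, e2] at h1
        exact h1)
    refine ⟨Fin.cons t x, fun k => ?_⟩
    rw [Fin.sum_univ_succ]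
    have := ht k
    simp only [Fin.cons_zero, Fin.cons_succ]
    linarith

theorem exists_solution_of_nat_certificates {ι J : Type} [Fintype ι] [Fintype J]
    (a : ι → J → ℤ) (b : ι → ℝ)
    (h : ∀ u : ι → ℕ, (∀ j, ∑ k, (u k : ℤ) * a k j = 0) → 0 ≤ ∑ k, (u k : ℝ) * b k) :
    ∃ x : J → ℝ, ∀ k, ∑ j, (a k j : ℝ) * x j ≤ b k := by
  let e := Fintype.equivFin J
  obtain ⟨x, hx⟩ := exists_solution_of_nat_certificates_fin (Fintype.card J)
    (fun k j => a k (e.symm j)) b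
    (fun u hu => h u fun j => by simpa using hu (e j))
  refine ⟨fun j => x (e j), fun k => ?_⟩
  rw [← e.symm.sum_comp]
  simpa using hx k

/-! ### Families and covers -/

/-- A finite family with prescribed multiplicities. -/
theorem exists_family_of_multiplicities {N : Type*} [Fintype N] (μ : N → ℕ) :
    ∃ (k : ℕ) (A : Fin k → N),
      ∀ {M : Type} [AddCommMonoid M] (g : N → M), ∑ i, g (A i) = ∑ S, μ S • g S := by
  let e := Fintype.equivFin (Σ S, Fin (μ S))
  refine ⟨_, fun i => (e.symm i).1, fun g => ?_⟩
  rw [e.symm.sum_comp fun q => g q.1, Fintype.sum_sigma]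
  simp

/-- By Hall's theorem, `A` covers `B` if this is not excluded by counting on lower sets. -/
theorem covers_of_card_le {n k m : ℕ} (A : Fin k → NonemptySubset n)
    (B : Fin m → NonemptySubset n)
    (heq : ∀ e : Fin n, (Finset.univ.filter fun i => e ∈ (A i).1).card =
      (Finset.univ.filter fun j => e ∈ (B j).1).card)
    (hle : ∀ (e : Fin n) (D : Finset (NonemptySubset n)), (∀ S ∈ D, ∀ R, R ≤ S → R ∈ D) →
      (Finset.univ.filter fun j => B j ∈ D ∧ e ∈ (B j).1).card ≤
        (Finset.univ.filter fun i => A i ∈ D ∧ e ∈ (A i).1).card) :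
    Covers A B := by
  classical
  refine ⟨heq, ?_⟩
  have hall : ∀ e : Fin n, ∃ g : {j : Fin m // e ∈ (B j).1} → Fin k, Function.Injective g ∧
      ∀ j : {j : Fin m // e ∈ (B j).1},
        g j ∈ Finset.univ.filter fun i => A i ≤ B j ∧ e ∈ (A i).1 := by
    intro e
    rw [← Finset.all_card_le_biUnion_card_iff_exists_injective]
    intro X
    -- Hall's condition for `X` is the counting hypothesis on the lower set generated by its
    -- members.
    let D : Finset (NonemptySubset n) := Finset.univ.filter fun S => ∃ j ∈ X, S ≤ B j
    calc X.card = (X.map (Function.Embedding.subtype _)).card := by simp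
      _ ≤ (Finset.univ.filter fun j => B j ∈ D ∧ e ∈ (B j).1).card := by
          refine Finset.card_le_card fun j hj => ?_
          simp only [Finset.mem_map, Function.Embedding.subtype_apply] at hj
          obtain ⟨j', hj', rfl⟩ := hj
          simp only [D, Finset.mem_filter, Finset.mem_univ, true_and]
          exact ⟨⟨j', hj', le_rfl⟩, j'.2⟩
      _ ≤ (Finset.univ.filter fun i => A i ∈ D ∧ e ∈ (A i).1).card := by
          refine hle e D fun S hS R hR => ?_
          simp only [D, Finset.mem_filter, Finset.mem_univ, true_and] at hS ⊢
          obtain ⟨j, hj, hSj⟩ := hS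
          exact ⟨j, hj, hR.trans hSj⟩
      _ ≤ _ := by
          refine Finset.card_le_card fun i hi => ?_
          simp only [D, Finset.mem_filter, Finset.mem_univ, true_and] at hi
          obtain ⟨⟨j, hj, hij⟩, he⟩ := hi
          exact Finset.mem_biUnion.2 ⟨j, hj, by simp [hij, he]⟩
  choose g hg hmem using hall
  simp only [Finset.mem_filter, Finset.mem_univ, true_and] at hmem
  -- The matchings for the separate elements `e` glue to an injection, which is bijective because
  -- `heq` makes the two sides equinumerous.
  let h : (Σ j : Fin m, {s : Fin n // s ∈ (B j).1}) → Σ i : Fin k, {t : Fin n // t ∈ (A i).1} :=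
    fun q => ⟨g q.2.1 ⟨q.1, q.2.2⟩, ⟨q.2.1, (hmem q.2.1 ⟨q.1, q.2.2⟩).2⟩⟩
  have hinj : Function.Injective h := by
    rintro ⟨j, s, hs⟩ ⟨j', s', hs'⟩ hq
    have h1 : s = s' := congrArg (fun q => (q.2 : Fin n)) hq
    subst h1
    have h2 : g s ⟨j, hs⟩ = g s ⟨j', hs'⟩ := congrArg Sigma.fst hq
    have h3 := congrArg Subtype.val (hg s h2)
    simp only at h3
    subst h3
    rfl
  have hcard : Fintype.card (Σ j : Fin m, {s : Fin n // s ∈ (B j).1}) =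
      Fintype.card (Σ i : Fin k, {t : Fin n // t ∈ (A i).1}) := by
    have swap : ∀ {r : ℕ} (C : Fin r → NonemptySubset n),
        Fintype.card (Σ j : Fin r, {s : Fin n // s ∈ (C j).1}) =
          ∑ e : Fin n, (Finset.univ.filter fun j => e ∈ (C j).1).card := by
      intro r C
      simp only [Fintype.card_sigma, Fintype.card_coe]
      have := Finset.sum_card_bipartiteAbove_eq_sum_card_bipartiteBelow
        (s := Finset.univ) (t := Finset.univ) (fun (j : Fin r) (e : Fin n) => e ∈ (C j).1)
      simpa [Finset.bipartiteAbove, Finset.bipartiteBelow] using this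
    rw [swap, swap]
    exact Finset.sum_congr rfl fun e _ => (heq e).symm
  have hbij : Function.Bijective h := (Fintype.bijective_iff_injective_and_card h).2 ⟨hinj, hcard⟩
  refine ⟨(Equiv.ofBijective h hbij).symm, fun q => ?_⟩
  obtain ⟨q, rfl⟩ := hbij.2 q
  rw [Equiv.ofBijective_symm_apply_apply]
  exact ⟨rfl, (hmem q.2.1 ⟨q.1, q.2.2⟩).1⟩

/-! ### The cone as a projection of a polyhedron -/

/-- The vectors satisfying the nonuniform-cover inequalities are the vectors of sums of
antitone side lengths. -/
theorem mem_nonuniformCoverCone_iff {n : ℕ} (p : NonemptySubset n → ℝ) :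
    p ∈ nonuniformCoverCone n ↔ ∃ x : NonemptySubset n → Fin n → ℝ,
      (∀ S T : NonemptySubset n, S ≤ T → ∀ i ∈ S.1, x T i ≤ x S i) ∧
        ∀ S, p S = ∑ i ∈ S.1, x S i := by
  classical
  constructor
  · intro hp
    -- The rows of `a` are the monotonicity constraints and each equation for `p S`, split into two
    -- inequalities.
    let d : NonemptySubset n → Fin n → NonemptySubset n × Fin n → ℤ := fun S i => Pi.single (S, i) 1
    let a : (NonemptySubset n × NonemptySubset n × Fin n) ⊕ NonemptySubset n ⊕ NonemptySubset n →
        NonemptySubset n × Fin n → ℤ :=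
      Sum.elim (fun q => if q.1 ≤ q.2.1 ∧ q.2.2 ∈ q.1.1 then d q.2.1 q.2.2 - d q.1 q.2.2 else 0)
        (Sum.elim (fun S => ∑ i ∈ S.1, d S i) (fun S => -∑ i ∈ S.1, d S i))
    obtain ⟨x, hx⟩ := exists_solution_of_nat_certificates a
      (Sum.elim (fun _ => 0) (Sum.elim p (fun S => -p S))) (by
        intro u hu
        obtain ⟨k, A, hA⟩ := exists_family_of_multiplicities (fun S => u (Sum.inr (Sum.inl S)))
        obtain ⟨m, B, hB⟩ := exists_family_of_multiplicities (fun S => u (Sum.inr (Sum.inr S)))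
        have hd : ∀ (D : Finset (NonemptySubset n)) (e : Fin n) S i,
            ∑ R ∈ D.filter (fun R => e ∈ R.1), d S i (R, e) =
              if S ∈ D ∧ e ∈ S.1 ∧ i = e then 1 else 0 := by
          intro D e S i
          by_cases hie : i = e
          · subst hie
            simp [d, Pi.single_apply, Finset.sum_ite_eq']
          · have : ∀ R, ¬ (R, e) = (S, i) := fun R h => hie (congrArg Prod.snd h).symm
            simp [d, hie, this]
        have hcard : ∀ (D : Finset (NonemptySubset n)) (e : Fin n) {r : ℕ}
            (C : Fin r → NonemptySubset n),
            ((Finset.univ.filter fun j => C j ∈ D ∧ e ∈ (C j).1).card : ℤ) =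
              ∑ j, if C j ∈ D ∧ e ∈ (C j).1 then 1 else 0 := by
          intro D e r C
          simp
        -- The certificate's vanishing conditions, summed over the coordinates `(R, e)` with `e ∈ R
        -- ∈ D`.
        have bal : ∀ (D : Finset (NonemptySubset n)) (e : Fin n),
            (∑ q : NonemptySubset n × NonemptySubset n × Fin n,
              (u (Sum.inl q) : ℤ) * ∑ R ∈ D.filter (fun R => e ∈ R.1), a (Sum.inl q) (R, e)) +
            (Finset.univ.filter fun i => A i ∈ D ∧ e ∈ (A i).1).card -
            (Finset.univ.filter fun j => B j ∈ D ∧ e ∈ (B j).1).card = 0 := by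
          intro D e
          have h0 : ∑ R ∈ D.filter (fun R => e ∈ R.1), ∑ k, (u k : ℤ) * a k (R, e) = 0 :=
            Finset.sum_eq_zero fun R _ => hu (R, e)
          rw [Finset.sum_comm] at h0
          simp_rw [← Finset.mul_sum] at h0
          rw [Fintype.sum_sum_type, Fintype.sum_sum_type] at h0
          have hrow : ∀ S : NonemptySubset n,
              ∑ R ∈ D.filter (fun R => e ∈ R.1), (∑ i ∈ S.1, d S i) (R, e) =
                if S ∈ D ∧ e ∈ S.1 then 1 else 0 := by
            intro S
            simp_rw [Finset.sum_apply]
            rw [Finset.sum_comm]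
            simp_rw [hd]
            by_cases hS : S ∈ D <;> by_cases he : e ∈ S.1 <;> simp [hS, he]
          rw [hcard, hcard, hA fun S => if S ∈ D ∧ e ∈ S.1 then (1 : ℤ) else 0,
            hB fun S => if S ∈ D ∧ e ∈ S.1 then (1 : ℤ) else 0]
          refine Eq.trans ?_ h0
          simp only [a, Sum.elim_inr, Sum.elim_inl, Pi.neg_apply, Finset.sum_neg_distrib, hrow,
            nsmul_eq_mul, mul_neg]
          ring
        have hcov : Covers A B := by
          refine covers_of_card_le A B (fun e => ?_) (fun e D hD => ?_)
          · have h1 := bal Finset.univ e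
            rw [Finset.sum_eq_zero] at h1
            · simp only [Finset.mem_univ, true_and] at h1
              omega
            · rintro ⟨S, T, i⟩ -
              simp only [a, Sum.elim_inl]
              split_ifs with hST
              · have hiT : i ∈ T.1 := hST.1 hST.2
                have hiS : i ∈ S.1 := hST.2
                simp only [Pi.sub_apply, Finset.sum_sub_distrib, hd]
                by_cases hie : i = e
                · subst hie
                  simp [hiS, hiT]
                · simp [hie]
              · simp
          -- As `D` is a lower set, `T ∈ D` forces `S ∈ D` when `S ≤ T`, so every monotonicity row
          -- contributes at most `0`.
          · have h1 := bal D e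
            have h2 : (∑ q : NonemptySubset n × NonemptySubset n × Fin n,
                (u (Sum.inl q) : ℤ) * ∑ R ∈ D.filter (fun R => e ∈ R.1), a (Sum.inl q) (R, e))
                ≤ 0 := by
              refine Finset.sum_nonpos ?_
              rintro ⟨S, T, i⟩ -
              refine mul_nonpos_of_nonneg_of_nonpos (by positivity) ?_
              simp only [a, Sum.elim_inl]
              split_ifs with hST
              · have hiT : i ∈ T.1 := hST.1 hST.2
                have hiS : i ∈ S.1 := hST.2
                have hTS : T ∈ D → S ∈ D := fun h => hD T h S hST.1
                simp only [Pi.sub_apply, Finset.sum_sub_distrib, hd]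
                by_cases hie : i = e
                · subst hie
                  by_cases hT : T ∈ D
                  · simp [hiS, hiT, hT, hTS hT]
                  · simp only [hT, false_and, if_false]
                    split_ifs <;> simp
                · simp [hie]
              · simp
            omega
        have := hp k m A B hcov
        rw [hA p, hB p] at this
        simp only [nsmul_eq_mul] at this
        rw [Fintype.sum_sum_type, Fintype.sum_sum_type]
        simp only [Sum.elim_inl, Sum.elim_inr, mul_zero, Finset.sum_const_zero, mul_neg,
          Finset.sum_neg_distrib]
        linarith)
    have hdx : ∀ S i, ∑ j, ((d S i j : ℤ) : ℝ) * x j = x (S, i) := by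
      intro S i
      simp [d, Pi.single_apply]
    have hsx : ∀ S : NonemptySubset n,
        ∑ j, (((∑ i ∈ S.1, d S i) j : ℤ) : ℝ) * x j = ∑ i ∈ S.1, x (S, i) := by
      intro S
      simp_rw [Finset.sum_apply, Int.cast_sum, Finset.sum_mul]
      rw [Finset.sum_comm]
      simp_rw [hdx]
    refine ⟨fun S i => x (S, i), fun S T hST i hi => ?_, fun S => ?_⟩
    · have := hx (Sum.inl (S, T, i))
      simp only [a, Sum.elim_inl, hST, hi, and_self, if_true, Pi.sub_apply, Int.cast_sub, sub_mul,
        Finset.sum_sub_distrib, hdx] at this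
      linarith
    · have h1 := hx (Sum.inr (Sum.inl S))
      have h2 := hx (Sum.inr (Sum.inr S))
      simp only [a, Sum.elim_inl, Sum.elim_inr, Pi.neg_apply, Int.cast_neg, neg_mul,
        Finset.sum_neg_distrib, hsx] at h1 h2
      linarith
  · rintro ⟨x, hx, hp⟩ k m A B ⟨-, f, hf⟩
    have tokens : ∀ {r : ℕ} (C : Fin r → NonemptySubset n),
        ∑ j, p (C j) = ∑ q : Σ j, {s : Fin n // s ∈ (C j).1}, x (C q.1) q.2 := by
      intro r C
      rw [Fintype.sum_sigma]
      refine Finset.sum_congr rfl fun j _ => ?_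
      rw [hp, ← Finset.sum_coe_sort]
    rw [tokens, tokens, ← f.sum_comp]
    refine Finset.sum_le_sum fun q _ => ?_
    rw [(hf q).1]
    exact hx _ _ (hf q).2 _ q.2.2

/-! ### Rectangular flowers -/

/-- The volume of a projection of a rectangular flower. -/
theorem projVolume_eq_prod {n : ℕ} {F : Set (Fin n → ℝ)} (hF : IsObject F) (hc : IsCornered F)
    {S : Finset (Fin n)} {a : Fin n → ℝ} (ha : F ∩ openFace S = openRectangle S a) :
    projVolume F S = ∏ i ∈ S, ENNReal.ofReal (a i) := by
  classical
  let proj : (Fin n → ℝ) → S → ℝ := fun x i => x i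
  let ext : (S → ℝ) → Fin n → ℝ := fun y i => if h : i ∈ S then y ⟨i, h⟩ else 0
  have hext : ∀ y (i : S), ext y i = y i := fun y i => by simp [ext]
  have hbox : MeasureTheory.volume (Set.univ.pi fun i : S => Set.Ioc 0 (a i)) =
      ∏ i ∈ S, ENNReal.ofReal (a i) := by
    rw [Real.volume_pi_Ioc]
    simpa using Finset.prod_coe_sort S fun i => ENNReal.ofReal (a i)
  have hsub : (Set.univ.pi fun i : S => Set.Ioc 0 (a i)) ⊆ proj '' F := by
    intro y hy
    have hy' : ∀ i : S, 0 < y i ∧ y i ≤ a i := fun i => hy i trivial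
    have : ext y ∈ openRectangle S a := by
      refine ⟨fun i hi => ?_, fun i hi => by simp [ext, hi]⟩
      simpa [ext, hi] using hy' ⟨i, hi⟩
    rw [← ha] at this
    exact ⟨ext y, this.1, funext fun i => hext y i⟩
  -- Up to the null coordinate hyperplanes, a projected point is positive on `S`; zeroing its
  -- preimage off `S` stays in `F` by corneredness.
  have hsup : proj '' F ⊆ (Set.univ.pi fun i : S => Set.Ioc 0 (a i)) ∪
      ⋃ i : S, {y : S → ℝ | y i = 0} := by
    rintro _ ⟨z, hz, rfl⟩
    by_cases h0 : ∃ i : S, z i = 0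
    · obtain ⟨i, hi⟩ := h0
      exact Or.inr (Set.mem_iUnion.2 ⟨i, hi⟩)
    · push Not at h0
      left
      have hpos : ∀ i ∈ S, 0 < z i := fun i hi =>
        lt_of_le_of_ne (hF.2 z hz i) (h0 ⟨i, hi⟩).symm
      have hmem : (fun i => if i ∈ S then z i else 0) ∈ F ∩ openFace S := by
        refine ⟨hc z hz _ (fun i => ?_) (fun i => ?_), fun i hi => ?_, fun i hi => ?_⟩
        · by_cases hi : i ∈ S <;> simp [hi, hF.2 z hz i]
        · by_cases hi : i ∈ S <;> simp [hi, hF.2 z hz i]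
        · simpa [hi] using hpos i hi
        · simp [hi]
      rw [ha] at hmem
      rintro ⟨i, hi⟩ -
      simpa [hi] using hmem.1 i hi
  have hnull : MeasureTheory.volume (⋃ i : S, {y : S → ℝ | y i = 0}) = 0 := by
    rw [MeasureTheory.measure_iUnion_null_iff]
    exact fun i => MeasureTheory.Measure.pi_hyperplane _ i 0
  refine le_antisymm ?_ ?_
  · calc projVolume F S ≤ _ := MeasureTheory.measure_mono hsup
      _ ≤ _ := MeasureTheory.measure_union_le _ _
      _ = _ := by rw [hnull, hbox, add_zero]
  · rw [← hbox]
    exact MeasureTheory.measure_mono hsub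

theorem log_prod_ofReal_eq {ι : Type*} (S : Finset ι) (a : ι → ℝ) (ha : ∀ i ∈ S, 0 < a i) :
    ENNReal.log (∏ i ∈ S, ENNReal.ofReal (a i)) = ((∑ i ∈ S, Real.log (a i) : ℝ) : EReal) := by
  rw [← ENNReal.ofReal_prod_of_nonneg fun i hi => (ha i hi).le,
    ENNReal.log_ofReal_of_pos (Finset.prod_pos ha), Real.log_prod fun i hi => (ha i hi).ne']

/-- Logarithms of box sides give `x`; conversely, the union of the boxes with sides `exp (x S i)` is
a flower. -/
theorem mem_rectangularFlowerRegion_iff {n : ℕ} (p : NonemptySubset n → ℝ) :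
    p ∈ rectangularFlowerRegion n ↔ ∃ x : NonemptySubset n → Fin n → ℝ,
      (∀ S T : NonemptySubset n, S ≤ T → ∀ i ∈ S.1, x T i ≤ x S i) ∧
        ∀ S, p S = ∑ i ∈ S.1, x S i := by
  classical
  constructor
  · rintro ⟨F, ⟨hF, hc, hr⟩, hp⟩
    choose a ha using hr
    have hpos : ∀ S : NonemptySubset n, ∀ i ∈ S.1, 0 < a S.1 i := by
      intro S i hi
      by_contra hai
      have h0 : ∏ i ∈ S.1, ENNReal.ofReal (a S.1 i) = 0 :=
        Finset.prod_eq_zero hi (ENNReal.ofReal_of_nonpos (not_lt.1 hai))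
      have := hp S
      rw [logProjection, projVolume_eq_prod hF hc (ha S.1), h0, ENNReal.log_zero] at this
      exact EReal.coe_ne_bot _ this
    refine ⟨fun S i => Real.log (a S.1 i), fun S T hST i hi => ?_, fun S => ?_⟩
    · refine Real.log_le_log (hpos T i (hST hi)) ?_
      -- The far corner of the box on `T`, truncated to `S`, must lie in the box on `S`.
      have hT : (fun i => if i ∈ T.1 then a T.1 i else 0) ∈ F := by
        have : (fun i => if i ∈ T.1 then a T.1 i else 0) ∈ openRectangle T.1 (a T.1) :=
          ⟨fun i hi => by simpa [hi] using hpos T i hi, fun i hi => by simp [hi]⟩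
        rw [← ha] at this
        exact this.1
      have hS : (fun i => if i ∈ S.1 then a T.1 i else 0) ∈ F ∩ openFace S.1 := by
        refine ⟨hc _ hT _ (fun i => ?_) (fun i => ?_), fun i hi => ?_, fun i hi => ?_⟩
        · by_cases hi : i ∈ S.1
          · simpa [hi] using (hpos T i (hST hi)).le
          · simp [hi]
        · by_cases hi : i ∈ S.1
          · have hiT : i ∈ T.1 := hST hi
            simp [hi, hiT]
          · by_cases hiT : i ∈ T.1
            · simpa [hi, hiT] using (hpos T i hiT).le
            · simp [hi, hiT]
        · simpa [hi] using hpos T i (hST hi)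
        · simp [hi]
      rw [ha] at hS
      simpa [hi] using (hS.1 i hi).2
    · have := hp S
      rw [logProjection, projVolume_eq_prod hF hc (ha S.1),
        log_prod_ofReal_eq _ _ (hpos S)] at this
      exact_mod_cast this
  · rintro ⟨x, hx, hp⟩
    -- The default `0` off `S` flattens `Icc 0 (a S)` into the closed face of `S`; for empty `S` it
    -- is the origin.
    let a : Finset (Fin n) → Fin n → ℝ := fun S i =>
      if h : S.Nonempty then (if i ∈ S then Real.exp (x ⟨S, h⟩ i) else 0) else 0
    have ha_mem : ∀ (S : NonemptySubset n) i, i ∈ S.1 → a S.1 i = Real.exp (x S i) := by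
      intro S i hi
      simp [a, S.2, hi]
    have ha_not : ∀ S i, i ∉ S → a S i = 0 := by
      intro S i hi
      by_cases h : S.Nonempty <;> simp [a, h, hi]
    have ha_anti : ∀ S T i, S ⊆ T → i ∈ S → a T i ≤ a S i := by
      intro S T i hST hi
      have h1 := ha_mem ⟨S, i, hi⟩ i hi
      have h2 := ha_mem ⟨T, i, hST hi⟩ i (hST hi)
      simp only at h1 h2
      rw [h1, h2]
      exact Real.exp_le_exp.2 (hx ⟨S, i, hi⟩ ⟨T, i, hST hi⟩ hST i hi)
    let F : Set (Fin n → ℝ) := ⋃ S : Finset (Fin n), Set.Icc 0 (a S)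
    have hF : IsObject F := by
      refine ⟨isCompact_iUnion fun S => isCompact_Icc, fun z hz i => ?_⟩
      obtain ⟨S, hS⟩ := Set.mem_iUnion.1 hz
      exact hS.1 i
    have hc : IsCornered F := by
      intro z hz y hy0 hyz
      obtain ⟨S, hS⟩ := Set.mem_iUnion.1 hz
      exact Set.mem_iUnion.2 ⟨S, hy0, fun i => (hyz i).trans (hS.2 i)⟩
    have hr : ∀ S, F ∩ openFace S = openRectangle S (a S) := by
      intro S
      ext z
      constructor
      · rintro ⟨hz, hzS⟩
        obtain ⟨T, hT⟩ := Set.mem_iUnion.1 hz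
        have hST : S ⊆ T := by
          intro i hi
          by_contra hiT
          have h1 := hT.2 i
          rw [ha_not T i hiT] at h1
          exact absurd (hzS.1 i hi) (not_lt.2 h1)
        exact ⟨fun i hi => ⟨hzS.1 i hi, (hT.2 i).trans (ha_anti S T i hST hi)⟩, hzS.2⟩
      · intro hz
        refine ⟨Set.mem_iUnion.2 ⟨S, fun i => ?_, fun i => ?_⟩, fun i hi => (hz.1 i hi).1, hz.2⟩
        · by_cases hi : i ∈ S
          · exact (hz.1 i hi).1.le
          · exact (hz.2 i hi).ge
        · by_cases hi : i ∈ S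
          · exact (hz.1 i hi).2
          · rw [hz.2 i hi, ha_not S i hi]
    refine ⟨F, ⟨hF, hc, fun S => ⟨a S, hr S⟩⟩, fun S => ?_⟩
    rw [logProjection, projVolume_eq_prod hF hc (hr S.1), log_prod_ofReal_eq, hp S]
    · congr 1
      refine Finset.sum_congr rfl fun i hi => ?_
      rw [ha_mem S i hi, Real.log_exp]
    · intro i hi
      rw [ha_mem S i hi]
      exact Real.exp_pos _

theorem theorem3 (n : ℕ) (hn : 1 ≤ n) :
    nonuniformCoverCone n = rectangularFlowerRegion n ∧
      rectangularFlowerRegion n ⊆ constructibleRegion n := by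
  refine ⟨?_, ?_⟩
  · ext p
    rw [mem_nonuniformCoverCone_iff, mem_rectangularFlowerRegion_iff]
  · rintro p ⟨F, hF, hp⟩
    exact ⟨F, hF.1, hp⟩
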